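/- Let $\mathbb S^n$ be the space of real symmetric $n\times n$ matrices with inner product $\langle X,Y\rangle=\mathrm{tr}(XY)$ and Frobenius norm $\|\cdot\|_F$; let $\lambda_i(X)$ be the $i$-th largest eigenvalue of $X\in\mathbb S^n$, and let $\mathcal S_n=\{X\in\mathbb S^n: X\succeq 0,\ \mathrm{tr}\,X=1\}$. Let $\mathcal A:\mathbb S^n\to\mathbb R^m$ be linear with $\|\mathcal A\|_{\rm op}=\max_{\|X\|_F=1}\|\mathcal A X\|_2$, let $C\in\mathbb S^n$, let $g:\mathbb R^m\to\mathbb R$ be differentiable with $L_g$-Lipschitz gradient, and suppose that $f(X)=g(\mathcal A X)+\langle C,X\rangle$ is convex on $\mathcal S_n$. Consider the problem of minimizing $f$ over $\mathcal S_n$, and assume: (i) it has a unique optimal solution $X_\star$, and $r_\star=\mathrm{rank}(X_\star)$; (ii) strict complementarity: $Z_\star\in\mathbb S^n$ and $s_\star\in\mathbb R$ satisfy the KKT conditions $\nabla f(X_\star)-Z_\star-s_\star I=0$, $\langle Z_\star,X_\star\rangle=0$, $Z_\star\succeq0$ (together with $X_\star\in\mathcal S_n$), and $\mathrm{rank}(X_\star)+\mathrm{rank}(Z_\star)=n$;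 (iii) quadratic growth with parameter $\gamma>0$: $f(X)-f(X_\star)\ge\gamma\|X-X_\star\|_F^2$ for all $X\in\mathcal S_n$. Let $r_\star\le k\le n$, and let $(X_t)_{t\ge0}$ be produced by the Spectral Frank-Wolfe algorithm: $X_0\in\mathcal S_n$ is arbitrary and, for each $t\ge0$, one takes $V\in\mathbb R^{n\times k}$ whose columns are orthonormal eigenvectors of $\nabla f(X_t)$ for its $k$ smallest eigenvalues (counted with multiplicity), takes any minimizer $(\hat\eta,\hat S)$ of $f(\eta X_t+VSV^\top)$ over $\eta\ge0$, $S\in\mathbb S^k$, $S\succeq0$, $\eta+\mathrm{tr}\,S=1$, and sets $X_{t+1}=\hat\eta X_t+V\hat SV^\top$. Put $\beta=\|\mathcal A\|_{\rm op}^2L_g$ and $h_t=f(X_t)-f(X_\star)$. Then $$h_t\le\frac{8\beta}{t}\qquad\text{for all } t\ge1 .$$ Moreover, if $r_\star<n$ and $\beta>0$, then for all $t\ge T_0=\dfrac{72\beta^3}{\gamma\,\lambda_{n-r_\star}(Z_\star)^2}$, $$h_{t+1}\le\Bigl(1-\min\Bigl\{\tfrac12,\ \frac{\gamma}{4\beta},\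 \frac{\lambda_{n-r_\star}(Z_\star)}{12\beta}\Bigr\}\Bigr)h_t .$$ (If $\beta=0$, the first bound already gives $h_t=0$ for all $t\ge1$.) -/

import Mathlib

open scoped NNReal Matrix Gradient RealInnerProductSpace

noncomputable section

/-- The linear subspace of symmetric matrices in `ℝ^{n × n}`. -/
def symSubmodule (n : ℕ) : Submodule ℝ (Matrix (Fin n) (Fin n) ℝ) where
  carrier := {M | M.IsSymm}
  add_mem' hA hB := Matrix.IsSymm.add hA hB
  zero_mem' := Matrix.isSymm_zero
  smul_mem' c _ hA := Matrix.IsSymm.smul hA c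

/-- The space `𝕊ⁿ` of real symmetric `n × n` matrices. It is a separate type, so that the only norm
it carries is the one of the trace inner product. -/
def SymMat (n : ℕ) : Type := symSubmodule n

namespace SymMat

variable {n : ℕ}

instance : AddCommGroup (SymMat n) := inferInstanceAs (AddCommGroup (symSubmodule n))

instance : Module ℝ (SymMat n) := inferInstanceAs (Module ℝ (symSubmodule n))

instance : FiniteDimensional ℝ (SymMat n) :=
  inferInstanceAs (FiniteDimensional ℝ (symSubmodule n))

/-- The underlying matrix of an element of `𝕊ⁿ`. -/
def mat : SymMat n →ₗ[ℝ] Matrix (Fin n) (Fin n) ℝ := (symSubmodule n).subtype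

/-- A symmetric matrix as an element of `𝕊ⁿ`. -/
def ofMat (M : Matrix (Fin n) (Fin n) ℝ) (hM : M.IsSymm) : SymMat n := ⟨M, hM⟩

@[simp] theorem mat_ofMat (M : Matrix (Fin n) (Fin n) ℝ) (hM : M.IsSymm) :
    mat (ofMat M hM) = M := rfl

theorem isSymm (X : SymMat n) : (mat X).IsSymm := X.2

theorem isHermitian (X : SymMat n) : (mat X).IsHermitian := by
  rw [Matrix.IsHermitian, Matrix.conjTranspose_eq_transpose_of_trivial]
  exact X.isSymm

theorem mat_injective : Function.Injective (mat : SymMat n → Matrix (Fin n) (Fin n) ℝ) :=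
  Subtype.val_injective

/-- The trace inner product `⟨X, Y⟩ = tr (X Y)` on `𝕊ⁿ`. -/
abbrev innerCore : InnerProductSpace.Core ℝ (SymMat n) where
  inner X Y := (mat X * mat Y).trace
  conj_inner_symm X Y := by simp [Matrix.trace_mul_comm (mat Y) (mat X)]
  re_inner_nonneg X := by
    have h : 0 ≤ ((mat X)ᴴ * mat X).trace :=
      (Matrix.posSemidef_conjTranspose_mul_self (mat X)).trace_nonneg
    rw [X.isHermitian.eq] at h
    exact h
  add_left X Y Z := by simp [add_mul]
  smul_left X Y c := by simp
  definite X h := by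
    have h' : ((mat X)ᴴ * mat X).trace = 0 := by rw [X.isHermitian.eq]; exact h
    exact mat_injective (by simpa using Matrix.trace_conjTranspose_mul_self_eq_zero_iff.mp h')

/-- The norm of the trace inner product, that is, the Frobenius norm. -/
instance : NormedAddCommGroup (SymMat n) := (innerCore (n := n)).toNormedAddCommGroup

instance : InnerProductSpace ℝ (SymMat n) := InnerProductSpace.ofCore innerCore.toCore

instance : CompleteSpace (SymMat n) := FiniteDimensional.complete ℝ (SymMat n)

/-- The identity matrix. -/
def id (n : ℕ) : SymMat n := ofMat 1 Matrix.isSymm_one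

/-- The matrix `V S Vᵀ ∈ 𝕊ⁿ`, for `V ∈ ℝ^{n × k}` and `S ∈ 𝕊ᵏ`. -/
def conj {k : ℕ} (V : Matrix (Fin n) (Fin k) ℝ) (S : SymMat k) : SymMat n :=
  ofMat (V * mat S * Vᵀ) (by
    rw [Matrix.IsSymm, Matrix.transpose_mul, Matrix.transpose_mul, Matrix.transpose_transpose,
      S.isSymm.eq, Matrix.mul_assoc])

/-- `λ_i(X)`, the `i`-th largest eigenvalue of `X ∈ 𝕊ⁿ` counted with multiplicity,
for `1 ≤ i ≤ n`. -/
def eigval (X : SymMat n) (i : ℕ) (h1 : 1 ≤ i) (h2 : i ≤ n) : ℝ :=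
  X.isHermitian.eigenvalues₀ ⟨i - 1, by rw [Fintype.card_fin]; omega⟩

end SymMat

/-- The spectrahedron `𝒮_n = {X ∈ 𝕊ⁿ : X ⪰ 0, tr X = 1}`. -/
def spectrahedron (n : ℕ) : Set (SymMat n) :=
  {X | X.mat.PosSemidef ∧ X.mat.trace = 1}

/-- The objective `f(X) = g(𝒜 X) + ⟨C, X⟩`. -/
def objective {n m : ℕ} (g : EuclideanSpace ℝ (Fin m) → ℝ)
    (A : SymMat n →L[ℝ] EuclideanSpace ℝ (Fin m)) (C : SymMat n) (X : SymMat n) : ℝ :=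
  g (A X) + ⟪C, X⟫

/-- `Xs` is the unique minimizer of `f` over the spectrahedron. -/
def IsUniqueSolution {n : ℕ} (f : SymMat n → ℝ) (Xs : SymMat n) : Prop :=
  Xs ∈ spectrahedron n ∧ ∀ X ∈ spectrahedron n, X ≠ Xs → f Xs < f X

/-- The KKT conditions for minimizing `f` over the spectrahedron, with dual solution `(Z, s)`. -/
structure IsKKT {n : ℕ} (f : SymMat n → ℝ) (X Z : SymMat n) (s : ℝ) : Prop where
  first_order : ∇ f X - Z - s • SymMat.id n = 0
  complementarity : ⟪Z, X⟫ = 0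
  trace_eq_one : X.mat.trace = 1
  dual_psd : Z.mat.PosSemidef
  primal_psd : X.mat.PosSemidef

/-- Strict complementarity of a primal-dual pair satisfying the KKT conditions. -/
def StrictComplementarity {n : ℕ} (f : SymMat n → ℝ) (X Z : SymMat n) (s : ℝ) : Prop :=
  IsKKT f X Z s ∧ X.mat.rank + Z.mat.rank = n

/-- Quadratic growth of `f` over the spectrahedron around `Xs` with parameter `γ > 0`. -/
def QuadraticGrowth {n : ℕ} (f : SymMat n → ℝ) (Xs : SymMat n) (γ : ℝ) : Prop :=
  0 < γ ∧ ∀ X ∈ spectrahedron n, γ * ‖X - Xs‖ ^ 2 ≤ f X - f Xs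

/-- The columns of `V ∈ ℝ^{n × k}` are orthonormal eigenvectors of `G` associated with its `k`
smallest eigenvalues (with multiplicity): every eigenvalue of `G` that has an eigenvector
orthogonal to all columns of `V` is at least as large as those of the columns. -/
def IsBottomEigenbasis {n k : ℕ} (G : SymMat n) (V : Matrix (Fin n) (Fin k) ℝ) : Prop :=
  Vᵀ * V = 1 ∧ ∃ μ : Fin k → ℝ,
    (∀ j, G.mat *ᵥ V.col j = μ j • V.col j) ∧
    ∀ (ν : ℝ) (w : Fin n → ℝ), w ≠ 0 → Vᵀ *ᵥ w = 0 → G.mat *ᵥ w = ν • w → ∀ j, μ j ≤ ν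

/-- The feasible set `{(η, S) : η + tr S = 1, S ⪰ 0, η ≥ 0}` of the small-scale SDP. -/
def subproblemFeasible (k : ℕ) : Set (ℝ × SymMat k) :=
  {p | p.1 + p.2.mat.trace = 1 ∧ p.2.mat.PosSemidef ∧ 0 ≤ p.1}

/-- One step `X ↦ Y` of Spectral Frank-Wolfe for `f` with `k` eigenvectors: with `V` collecting
eigenvectors of `∇ f X` for the `k` smallest eigenvalues and `(η, S)` an optimal solution of
`min f(η X + V S Vᵀ)` over the feasible pairs, `Y = η X + V S Vᵀ`. -/
def IsSpecFWStep {n : ℕ} (f : SymMat n → ℝ) (k : ℕ) (X Y : SymMat n) : Prop :=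
  ∃ (V : Matrix (Fin n) (Fin k) ℝ) (p : ℝ × SymMat k),
    IsBottomEigenbasis (∇ f X) V ∧
    p ∈ subproblemFeasible k ∧
    (∀ q ∈ subproblemFeasible k,
      f (p.1 • X + SymMat.conj V p.2) ≤ f (q.1 • X + SymMat.conj V q.2)) ∧
    Y = p.1 • X + SymMat.conj V p.2

/-- `X 0, X 1, …` is a run of Spectral Frank-Wolfe for `f` with parameter `k`. -/
def IsSpecFWRun {n : ℕ} (f : SymMat n → ℝ) (k : ℕ) (X : ℕ → SymMat n) : Prop :=
  X 0 ∈ spectrahedron n ∧ ∀ t, IsSpecFWStep f k (X t) (X (t + 1))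

end

/-!
# Convergence of Spectral Frank-Wolfe

Write `f` for the objective, `β = ‖A‖² Lg` for the smoothness constant of `f`, and `h` for the gap
`f X - f Xs` at the current iterate `X`. The next iterate minimizes `f` over a set that contains
every segment from `X` to a point `U = V S Vᵀ` with `S` in the spectrahedron of `𝕊ᵏ`. So the new
value is at most `f X + η ⟪∇ f X, U - X⟫ + η² β / 2 ‖U - X‖²`, for each such `U` and `η ∈ [0, 1]`,
and everything depends on a good choice of `U` and `η`.

*Sublinear rate.* For `U = v vᵀ`, with `v` a column of `V` belonging to the least eigenvalue of
`∇ f X`, one has `⟪∇ f X, U⟫ ≤ ⟪∇ f X, Xs⟫`, and convexity gives `h' ≤ (1 - η) h + β η²` for the new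
gap `h'`; the steps `η = 2 / (t + 2)` give `4 β / (t + 2)`
(`IsSpecFWStep.sub_le_frankWolfe`, `IsSpecFWRun.sub_le`).

*Linear rate.* Let `δ` be the least nonzero eigenvalue of `Zs`. By the KKT conditions `∇ f Xs` is
`Zs + s I`, and quadratic growth with the sublinear rate makes `∇ f X` differ from it by at most
`δ / 3` once `t ≥ T₀`. Strict complementarity bounds the quadratic form of `Zs` below by `δ` on a
subspace of codimension `r ≤ k`, so the eigenvalues of `∇ f X` on the orthogonal complement of the
columns of `V` are at least `s + 2 δ / 3`, while the least eigenvalue is at most `s + δ / 3`. Let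
`τ` be the trace of the part of `Xs` on that complement. Compress `Xs` to the column space of `V`
and return the lost trace `τ` to a bottom eigenvector: the result `U` satisfies
`‖Xs - U‖² ≤ 2 τ` (`Matrix.exists_compression_approx`) and `⟪∇ f X, Xs - U⟫ ≥ δ τ / 3`
(`IsBottomEigenbasis.exists_near`). With `‖U - X‖² ≤ 2 ‖Xs - U‖² + 2 ‖X - Xs‖²`, the linear gain
`η δ τ / 3` absorbs the first half of the quadratic term as soon as `η ≤ δ / (6 β)`, and quadratic
growth bounds the second half by `η h / 2` as soon as `η ≤ γ / (2 β)`
(`IsSpecFWStep.sub_le_of_gap`).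
-/

/-! ### Trace inequalities for positive semidefinite matrices -/

namespace Matrix

variable {ι κ : Type*} [Fintype ι] [DecidableEq ι] [Fintype κ] [DecidableEq κ]

theorem PosSemidef.exists_eq_transpose_mul_self {M : Matrix ι ι ℝ} (hM : M.PosSemidef) :
    ∃ B : Matrix ι ι ℝ, M = Bᵀ * B := by
  open scoped MatrixOrder in
  obtain ⟨B, hB⟩ := CStarAlgebra.nonneg_iff_eq_star_mul_self.mp hM.nonneg
  exact ⟨B, by rwa [star_eq_conjTranspose, conjTranspose_eq_transpose_of_trivial] at hB⟩

theorem PosSemidef.trace_mul_nonneg {A B : Matrix ι ι ℝ} (hA : A.PosSemidef)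
    (hB : B.PosSemidef) : 0 ≤ (A * B).trace := by
  obtain ⟨C, rfl⟩ := hB.exists_eq_transpose_mul_self
  rw [← Matrix.mul_assoc, trace_mul_comm, ← Matrix.mul_assoc]
  simpa using (hA.mul_mul_conjTranspose_same C).trace_nonneg

theorem PosSemidef.trace_mul_le {A B : Matrix ι ι ℝ} (hA : A.PosSemidef)
    (hB : B.PosSemidef) : (A * B).trace ≤ A.trace * B.trace := by
  obtain ⟨C, rfl⟩ := hA.exists_eq_transpose_mul_self
  obtain ⟨D, rfl⟩ := hB.exists_eq_transpose_mul_self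
  have h1 : (Cᵀ * C * (Dᵀ * D)).trace = ((C * Dᵀ) * (C * Dᵀ)ᵀ).trace := by
    rw [Matrix.mul_assoc, trace_mul_comm]
    simp only [transpose_mul, transpose_transpose, Matrix.mul_assoc]
  rw [h1, trace_mul_comm Cᵀ, trace_mul_comm Dᵀ]
  simp only [trace, diag_apply, mul_apply, transpose_apply]
  rw [Finset.sum_mul_sum]
  refine Finset.sum_le_sum fun i _ => Finset.sum_le_sum fun j _ => ?_
  simpa [sq] using Finset.sum_mul_sq_le_sq_mul_sq Finset.univ (C i) (D j)

/-- For the blocks of a positive semidefinite `X` cut out by `P` and `Q`, the off-diagonal block is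
controlled by the traces of the diagonal ones. -/
theorem PosSemidef.trace_mul_mul_mul_le {P Q X : Matrix ι ι ℝ} (hP : P.PosSemidef)
    (hQ : Q.PosSemidef) (hX : X.PosSemidef) :
    (P * X * (Q * X)).trace ≤ (P * X).trace * (Q * X).trace := by
  obtain ⟨B, rfl⟩ := hX.exists_eq_transpose_mul_self
  have h (R : Matrix ι ι ℝ) : (R * (Bᵀ * B)).trace = (B * R * Bᵀ).trace := by
    rw [← Matrix.mul_assoc, trace_mul_comm, ← Matrix.mul_assoc]
  have h2 : (P * (Bᵀ * B) * (Q * (Bᵀ * B))).trace = (B * P * Bᵀ * (B * Q * Bᵀ)).trace := by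
    rw [← Matrix.mul_assoc P, ← Matrix.mul_assoc Q, ← Matrix.mul_assoc, trace_mul_comm]
    simp only [Matrix.mul_assoc]
  rw [h, h, h2]
  exact PosSemidef.trace_mul_le (by simpa using hP.mul_mul_conjTranspose_same B)
    (by simpa using hQ.mul_mul_conjTranspose_same B)

/-! ### Eigenvalues on a subspace and on its complement -/

theorem IsHermitian.posSemidef_sub_smul_one {A : Matrix ι ι ℝ} (hA : A.IsHermitian) {c : ℝ}
    (h : ∀ (ν : ℝ) (w : ι → ℝ), w ≠ 0 → A *ᵥ w = ν • w → c ≤ ν) :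
    (A - c • (1 : Matrix ι ι ℝ)).PosSemidef := by
  have hH : (A - c • (1 : Matrix ι ι ℝ)).IsHermitian := by
    refine hA.sub ?_
    simp [IsHermitian]
  refine hH.posSemidef_iff_eigenvalues_nonneg.mpr fun i => ?_
  have h1 := hH.mulVec_eigenvectorBasis i
  have h2 : (hH.eigenvectorBasis i).ofLp ≠ 0 := by
    intro h0
    refine hH.eigenvectorBasis.orthonormal.ne_zero i ?_
    ext j
    exact congrFun h0 j
  have := h (hH.eigenvalues i + c) _ h2 (by
    rw [add_smul, ← h1, sub_mulVec, smul_mulVec, one_mulVec]; simp)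
  simpa using this

section Frame

variable {V : Matrix ι κ ℝ}

omit [DecidableEq ι] [DecidableEq κ] in
theorem posSemidef_mul_transpose (V : Matrix ι κ ℝ) : (V * Vᵀ).PosSemidef := by
  simpa using posSemidef_self_mul_conjTranspose V

theorem posSemidef_one_sub_mul_transpose (hV : Vᵀ * V = 1) :
    ((1 : Matrix ι ι ℝ) - V * Vᵀ).PosSemidef := by
  have h : ((1 : Matrix ι ι ℝ) - V * Vᵀ) = (1 - V * Vᵀ) * (1 - V * Vᵀ)ᵀ := by
    have : V * Vᵀ * (V * Vᵀ) = V * Vᵀ := by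
      rw [Matrix.mul_assoc, ← Matrix.mul_assoc Vᵀ, hV, Matrix.one_mul]
    simp [Matrix.mul_sub, Matrix.sub_mul, this]
  rw [h]
  exact posSemidef_mul_transpose _

/-- On the orthogonal complement of the invariant subspace spanned by the columns of `V`, the
quadratic form of `G` is bounded below by any lower bound `c` of the eigenvalues there. The bound is
stated after pairing with a positive semidefinite `M`. -/
theorem IsHermitian.le_trace_mul_compl {G : Matrix ι ι ℝ} {μ : κ → ℝ} {c : ℝ}
    (hG : G.IsHermitian) (hV : Vᵀ * V = 1) (hGV : G * V = V * diagonal μ)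
    (hc : ∀ (ν : ℝ) (w : ι → ℝ), w ≠ 0 → Vᵀ *ᵥ w = 0 → G *ᵥ w = ν • w → c ≤ ν)
    {M : Matrix ι ι ℝ} (hM : M.PosSemidef) :
    c * ((1 - V * Vᵀ) * M).trace ≤ (G * (1 - V * Vᵀ) * M).trace := by
  have hGt : Gᵀ = G := by simpa [IsHermitian] using hG
  have hVG : Vᵀ * G = diagonal μ * Vᵀ := by
    rw [← hGt, ← transpose_mul, hGV, transpose_mul, diagonal_transpose]
  have hGP : G * (V * Vᵀ) = V * diagonal μ * Vᵀ := by rw [← Matrix.mul_assoc, hGV]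
  -- `G` with its eigenvalues on the column space of `V` replaced by `c`
  set H : Matrix ι ι ℝ := G - G * (V * Vᵀ) + c • (V * Vᵀ) with hH
  have hHh : H.IsHermitian := by
    rw [hH, hGP]
    simp [IsHermitian, hGt, Matrix.mul_assoc]
  have hVH : Vᵀ * H = c • Vᵀ := by
    rw [hH, hGP]
    simp only [Matrix.mul_add, Matrix.mul_sub, hVG, ← Matrix.mul_assoc, hV, Matrix.one_mul,
      Matrix.mul_smul]
    simp
  have hpos : (H - c • (1 : Matrix ι ι ℝ)).PosSemidef := by
    refine hHh.posSemidef_sub_smul_one fun ν w hw hHw => ?_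
    by_contra! hlt
    have h1 : c • (Vᵀ *ᵥ w) = ν • (Vᵀ *ᵥ w) := by
      rw [← mulVec_smul Vᵀ ν, ← hHw, mulVec_mulVec, hVH, smul_mulVec]
    have h2 : Vᵀ *ᵥ w = 0 := by
      rw [← sub_eq_zero, ← sub_smul, smul_eq_zero] at h1
      exact h1.resolve_left (by linarith)
    refine absurd (hc ν w hw h2 ?_) (not_le.mpr hlt)
    rw [← hHw, hH, add_mulVec, sub_mulVec, smul_mulVec, ← mulVec_mulVec, ← mulVec_mulVec, h2]
    simp
  have := hpos.trace_mul_nonneg hM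
  have e : (H - c • (1 : Matrix ι ι ℝ)) * M
      = G * (1 - V * Vᵀ) * M - c • ((1 - V * Vᵀ) * M) := by
    rw [hH]
    simp only [Matrix.sub_mul, Matrix.mul_sub, Matrix.add_mul, Matrix.smul_mul, smul_sub,
      Matrix.one_mul, Matrix.mul_one]
    abel
  rw [e, trace_sub, trace_smul, smul_eq_mul] at this
  linarith

omit [DecidableEq ι] in
/-- Courant–Fischer, in the form needed: if the quadratic form of `G` is at least `c` on a subspace
of codimension at most `k`, then an eigenvalue that dominates `k` further ones is at least `c`. -/
theorem le_eigenvalue_of_subspace {G : Matrix ι ι ℝ} {μ : κ → ℝ} {c ν : ℝ}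
    {w : ι → ℝ} (hV : Vᵀ * V = 1) (hGV : G * V = V * diagonal μ)
    (K : Submodule ℝ (ι → ℝ)) (hK : ∀ u ∈ K, c * (u ⬝ᵥ u) ≤ u ⬝ᵥ G *ᵥ u)
    (hdim : Fintype.card ι ≤ Module.finrank ℝ K + Fintype.card κ)
    (hw : w ≠ 0) (hVw : Vᵀ *ᵥ w = 0) (hGw : G *ᵥ w = ν • w) (hμ : ∀ j, μ j ≤ ν) : c ≤ ν := by
  -- By dimension count `K` meets the span of `w` and the columns of `V`, where `G ≤ ν`.
  let L : (K × (κ → ℝ) × ℝ) →ₗ[ℝ] (ι → ℝ) :=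
    LinearMap.coprod K.subtype
      (LinearMap.coprod (-V.mulVecLin) (-(LinearMap.toSpanSingleton ℝ (ι → ℝ) w)))
  have hL : LinearMap.ker L ≠ ⊥ := by
    refine LinearMap.ker_ne_bot_of_finrank_lt ?_
    simp only [Module.finrank_prod, Module.finrank_fintype_fun_eq_card, Module.finrank_self]
    omega
  obtain ⟨⟨y, d, a⟩, hker, hne⟩ := (Submodule.ne_bot_iff _).mp hL
  have hy : (y : ι → ℝ) = V *ᵥ d + a • w := by
    have h : (y : ι → ℝ) + (-(V *ᵥ d) + -(a • w)) = 0 := by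
      simpa [L] using hker
    rw [← sub_eq_zero, ← h]; abel
  have hww : 0 < w ⬝ᵥ w := by
    have := dotProduct_star_self_pos_iff.mpr hw
    simpa using this
  have hVwd : ∀ d : κ → ℝ, (V *ᵥ d) ⬝ᵥ w = 0 := fun d => by
    rw [dotProduct_comm, dotProduct_mulVec, ← mulVec_transpose, hVw, zero_dotProduct]
  have hVV : ∀ d e : κ → ℝ, (V *ᵥ d) ⬝ᵥ (V *ᵥ e) = d ⬝ᵥ e := fun d e => by
    rw [dotProduct_mulVec, ← mulVec_transpose, mulVec_mulVec, hV, one_mulVec]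
  have hsq : (y : ι → ℝ) ⬝ᵥ y = d ⬝ᵥ d + a ^ 2 * (w ⬝ᵥ w) := by
    rw [hy]
    simp only [dotProduct_add, add_dotProduct, dotProduct_smul, smul_dotProduct, hVV, hVwd,
      dotProduct_comm w (V *ᵥ d), smul_eq_mul]
    ring
  have hGy : G *ᵥ y = V *ᵥ (diagonal μ *ᵥ d) + (a * ν) • w := by
    rw [hy, mulVec_add, mulVec_mulVec, hGV, mulVec_smul, hGw, smul_smul, mulVec_mulVec]
  have hquad : (y : ι → ℝ) ⬝ᵥ G *ᵥ y = d ⬝ᵥ (diagonal μ *ᵥ d) + ν * (a ^ 2 * (w ⬝ᵥ w)) := by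
    rw [hGy, hy]
    simp only [dotProduct_add, add_dotProduct, dotProduct_smul, smul_dotProduct, hVV, hVwd,
      dotProduct_comm w (V *ᵥ _), smul_eq_mul]
    ring
  have hdd : d ⬝ᵥ (diagonal μ *ᵥ d) ≤ ν * (d ⬝ᵥ d) := by
    simp only [dotProduct, mulVec_diagonal, Finset.mul_sum]
    refine Finset.sum_le_sum fun j _ => ?_
    nlinarith [hμ j, mul_self_nonneg (d j)]
  have hd0 : 0 ≤ d ⬝ᵥ d := by simpa using dotProduct_star_self_nonneg d
  have hpos : 0 < (y : ι → ℝ) ⬝ᵥ y := by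
    rw [hsq]
    by_contra! hle
    have ha : a = 0 := by
      by_contra ha
      have := mul_pos (pow_pos (abs_pos.mpr ha) 2) hww
      rw [sq_abs] at this
      linarith
    have hd : d = 0 := by
      rw [ha] at hle
      exact dotProduct_self_eq_zero.mp (le_antisymm (by simpa using hle) hd0)
    refine hne ?_
    have : y = 0 := Subtype.ext (by simp [hy, ha, hd])
    simp [this, hd, ha]
  have := hK y y.2
  rw [hquad] at this
  refine le_of_mul_le_mul_right ?_ hpos
  rw [hsq] at this ⊢
  linarith

end Frame

/-- A lower bound of the nonzero eigenvalues bounds the quadratic form on the range. -/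
theorem PosSemidef.le_dotProduct_mulVec_of_mem_range {Z : Matrix ι ι ℝ} (hZ : Z.PosSemidef) {δ : ℝ}
    (hδ : ∀ i, hZ.isHermitian.eigenvalues i ≠ 0 → δ ≤ hZ.isHermitian.eigenvalues i)
    {u : ι → ℝ} (hu : u ∈ LinearMap.range Z.mulVecLin) :
    δ * (u ⬝ᵥ u) ≤ u ⬝ᵥ Z *ᵥ u := by
  set b := hZ.isHermitian.eigenvectorBasis
  set l := hZ.isHermitian.eigenvalues with hl
  obtain ⟨x, rfl⟩ := hu
  have hZb : ∀ (v : ι → ℝ) i, (b i).ofLp ⬝ᵥ Z *ᵥ v = l i * ((b i).ofLp ⬝ᵥ v) := fun v i => by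
    have hZt : Zᵀ = Z := by simpa [IsHermitian] using hZ.isHermitian
    rw [dotProduct_mulVec, ← mulVec_transpose, hZt, hZ.isHermitian.mulVec_eigenvectorBasis,
      smul_dotProduct, smul_eq_mul]
  have hpars : ∀ v v' : ι → ℝ,
      v ⬝ᵥ v' = ∑ i, ((b i).ofLp ⬝ᵥ v) * ((b i).ofLp ⬝ᵥ v') := fun v v' => by
    have := b.sum_inner_mul_inner (WithLp.toLp 2 v) (WithLp.toLp 2 v')
    simp only [EuclideanSpace.inner_eq_star_dotProduct, star_trivial] at this
    rw [dotProduct_comm, ← this]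
    refine Finset.sum_congr rfl fun i _ => ?_
    rw [dotProduct_comm v']
  rw [mulVecLin_apply, hpars, hpars _ (Z *ᵥ (Z *ᵥ x)), Finset.mul_sum]
  refine Finset.sum_le_sum fun i _ => ?_
  simp only [hZb]
  by_cases h0 : l i = 0
  · simp [h0]
  · have := mul_le_mul_of_nonneg_right (hδ i h0) (mul_self_nonneg (l i * ((b i).ofLp ⬝ᵥ x)))
    linarith

/-! ### Compression to the column space of an orthonormal frame -/

/-- A density matrix `M` is approximated by one of the form `V S Vᵀ`: compress `M` to the column
space of `V` and put the lost trace `τ = tr ((1 - V Vᵀ) M)` on the `j`-th column. The squared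
distance is only linear in `τ` because the off-diagonal block of `M` is controlled by the diagonal
ones. -/
theorem exists_compression_approx {V : Matrix ι κ ℝ} {G M : Matrix ι ι ℝ} {μ : κ → ℝ}
    (hV : Vᵀ * V = 1) (hGV : G * V = V * diagonal μ) (hM : M.PosSemidef) (htr : M.trace = 1)
    (j : κ) :
    ∃ S : Matrix κ κ ℝ, S.PosSemidef ∧ S.trace = 1 ∧
      ((M - V * S * Vᵀ) * (M - V * S * Vᵀ)).trace ≤ 2 * ((1 - V * Vᵀ) * M).trace ∧
      (G * (M - V * S * Vᵀ)).trace =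
        (G * (1 - V * Vᵀ) * M).trace - μ j * ((1 - V * Vᵀ) * M).trace := by
  set Q : Matrix ι ι ℝ := 1 - V * Vᵀ with hQ
  have hQ0 : Q.PosSemidef := posSemidef_one_sub_mul_transpose hV
  set τ := (Q * M).trace with hτ
  set N := Vᵀ * M * V with hN
  set S := N + τ • single j j (1 : ℝ) with hS
  have hτ0 : 0 ≤ τ := hQ0.trace_mul_nonneg hM
  have hN0 : N.PosSemidef := by simpa using hM.conjTranspose_mul_mul_same V
  have hE0 : (single j j (1 : ℝ)).PosSemidef := by
    rw [← diagonal_single]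
    exact PosSemidef.diagonal (by intro i; by_cases h : i = j <;> simp [h])
  have hPM : (V * Vᵀ * M).trace = N.trace := by
    rw [hN, Matrix.mul_assoc, trace_mul_comm]
  have hNtr : N.trace = 1 - τ := by
    rw [← hPM, hτ, hQ, Matrix.sub_mul, trace_sub, Matrix.one_mul, htr]; ring
  -- the blocks of `M` along the splitting `1 = V Vᵀ + Q`
  have hblock : (M * M).trace ≤ (N * N).trace + 2 * τ - τ ^ 2 := by
    have hPP : (V * Vᵀ * M * (V * Vᵀ * M)).trace = (N * N).trace := by
      rw [hN, Matrix.mul_assoc V, Matrix.mul_assoc V, trace_mul_comm]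
      simp only [Matrix.mul_assoc]
    have h1 := (posSemidef_mul_transpose V).trace_mul_mul_mul_le hQ0 hM
    have h2 := hQ0.trace_mul_mul_mul_le hQ0 hM
    rw [hPM, hNtr] at h1
    have h3 : M * M = V * Vᵀ * M * (V * Vᵀ * M) + V * Vᵀ * M * (Q * M) + Q * M * (V * Vᵀ * M)
        + Q * M * (Q * M) := by
      rw [hQ]; noncomm_ring
    rw [h3, trace_add, trace_add, trace_add, trace_mul_comm (Q * M) (V * Vᵀ * M), hPP]
    nlinarith
  have hMS : (M * (V * S * Vᵀ)).trace = (N * S).trace := by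
    rw [hN, ← Matrix.mul_assoc, trace_mul_comm]
    simp only [Matrix.mul_assoc]
  have hSS : (V * S * Vᵀ * (V * S * Vᵀ)).trace = (S * S).trace := by
    rw [Matrix.mul_assoc V, Matrix.mul_assoc V, trace_mul_comm]
    simp only [Matrix.mul_assoc, hV, Matrix.mul_one]
    rw [← Matrix.mul_assoc Vᵀ V, hV, Matrix.one_mul]
  have hGVX (X : Matrix κ κ ℝ) : (G * (V * X * Vᵀ)).trace = (diagonal μ * X).trace := by
    rw [← Matrix.mul_assoc, ← Matrix.mul_assoc, hGV, trace_mul_comm]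
    simp only [← Matrix.mul_assoc, hV, Matrix.one_mul]
  refine ⟨S, hN0.add (hE0.smul hτ0), ?_, ?_, ?_⟩
  · simp [hS, hNtr]
  · have e1 : (N * S).trace = (N * N).trace + τ * (N * single j j (1 : ℝ)).trace := by
      rw [hS, Matrix.mul_add, trace_add, Matrix.mul_smul, trace_smul, smul_eq_mul]
    have e2 : (S * S).trace =
        (N * N).trace + 2 * (τ * (N * single j j (1 : ℝ)).trace) + τ ^ 2 := by
      simp only [hS, Matrix.mul_add, Matrix.add_mul, trace_add, Matrix.smul_mul, Matrix.mul_smul,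
        trace_smul, smul_eq_mul, trace_mul_comm (single j j (1 : ℝ)) N, single_mul_single_same,
        trace_single_eq_same]
      ring
    simp only [Matrix.sub_mul, Matrix.mul_sub, trace_sub, trace_mul_comm (V * S * Vᵀ) M, hMS, hSS]
    linarith
  · have e1 : (diagonal μ * S).trace = (diagonal μ * N).trace + μ j * τ := by
      simp only [hS, Matrix.mul_add, trace_add, Matrix.mul_smul, trace_smul, smul_eq_mul]
      rw [← diagonal_single, diagonal_mul_diagonal, trace_diagonal]
      simp [mul_comm, Pi.single_apply]
    have e2 : (G * (V * Vᵀ) * M).trace = (diagonal μ * N).trace := by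
      rw [← Matrix.mul_assoc, hGV, Matrix.mul_assoc, Matrix.mul_assoc, trace_mul_comm,
        Matrix.mul_assoc, hN]
    rw [Matrix.mul_sub, trace_sub, hGVX, e1, hQ, Matrix.mul_sub, Matrix.mul_one, Matrix.sub_mul,
      trace_sub, e2]
    ring

/-- A lower bound `c` of the eigenvalues of `G`, both on the columns of `V` and on their orthogonal
complement, bounds `tr (G M)` below for positive semidefinite `M`. -/
theorem IsHermitian.mul_trace_le {V : Matrix ι κ ℝ} {G M : Matrix ι ι ℝ} {μ : κ → ℝ} {c : ℝ}
    (hG : G.IsHermitian) (hV : Vᵀ * V = 1) (hGV : G * V = V * diagonal μ) (hμ : ∀ i, c ≤ μ i)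
    (hc : ∀ (ν : ℝ) (w : ι → ℝ), w ≠ 0 → Vᵀ *ᵥ w = 0 → G *ᵥ w = ν • w → c ≤ ν)
    (hM : M.PosSemidef) : c * M.trace ≤ (G * M).trace := by
  have h1 := hG.le_trace_mul_compl hV hGV hc hM
  have hN0 : (Vᵀ * M * V).PosSemidef := by simpa using hM.conjTranspose_mul_mul_same V
  have e1 : (V * Vᵀ * M).trace = (Vᵀ * M * V).trace := by
    rw [Matrix.mul_assoc, trace_mul_comm]
  have e2 : (G * (V * Vᵀ) * M).trace = (diagonal μ * (Vᵀ * M * V)).trace := by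
    rw [← Matrix.mul_assoc, hGV, Matrix.mul_assoc, Matrix.mul_assoc, trace_mul_comm,
      Matrix.mul_assoc]
  have h2 : c * (Vᵀ * M * V).trace ≤ (diagonal μ * (Vᵀ * M * V)).trace := by
    simp only [trace, diag_apply, diagonal_mul, Finset.mul_sum]
    exact Finset.sum_le_sum fun i _ => mul_le_mul_of_nonneg_right (hμ i) hN0.diag_nonneg
  simp only [Matrix.sub_mul, Matrix.mul_sub, trace_sub, Matrix.mul_one, Matrix.one_mul, e1, e2]
    at h1
  linarith

/-- For a positive semidefinite matrix of rank `q`, the `q`-th largest eigenvalue is the least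
nonzero one. -/
theorem PosSemidef.eigenvalues₀_pos_and_le {n : ℕ} {Z : Matrix (Fin n) (Fin n) ℝ}
    (hZ : Z.PosSemidef) {q : ℕ} (hq : Z.rank = q) (hq0 : 0 < q)
    (hqn : q - 1 < Fintype.card (Fin n)) :
    0 < hZ.isHermitian.eigenvalues₀ ⟨q - 1, hqn⟩ ∧
      ∀ i, hZ.isHermitian.eigenvalues i ≠ 0 →
        hZ.isHermitian.eigenvalues₀ ⟨q - 1, hqn⟩ ≤ hZ.isHermitian.eigenvalues i := by
  subst hq
  set l := hZ.isHermitian.eigenvalues₀ with hl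
  have hanti : Antitone l := hZ.isHermitian.eigenvalues₀_antitone
  let e : Fin (Fintype.card (Fin n)) ≃ Fin n := Fintype.equivOfCardEq (Fintype.card_fin _)
  have hle (i) : hZ.isHermitian.eigenvalues i = l (e.symm i) := rfl
  have h0 (j) : 0 ≤ l j := by
    have := hZ.eigenvalues_nonneg (e j)
    rwa [hle, e.symm_apply_apply] at this
  have hcard : Z.rank = (Finset.univ.filter fun j => l j ≠ 0).card := by
    rw [hZ.isHermitian.rank_eq_card_non_zero_eigs, Fintype.card_subtype]
    refine Finset.card_equiv e.symm fun i => ?_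
    simp [hle]
  constructor
  · refine lt_of_le_of_ne (h0 _) fun hz => ?_
    have : (Finset.univ.filter fun j => l j ≠ 0) ⊆ Finset.Iio ⟨Z.rank - 1, hqn⟩ := by
      intro j hj
      rw [Finset.mem_filter] at hj
      rw [Finset.mem_Iio]
      by_contra! hle
      exact hj.2 (le_antisymm ((hanti hle).trans_eq hz.symm) (h0 j))
    have := Finset.card_le_card this
    rw [← hcard, Fin.card_Iio] at this
    simp only at this
    omega
  · intro i hi
    rw [hle] at hi ⊢
    refine hanti ?_
    by_contra! hlt
    have : Finset.Iic (e.symm i) ⊆ (Finset.univ.filter fun j => l j ≠ 0) := by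
      intro j hj
      rw [Finset.mem_Iic] at hj
      rw [Finset.mem_filter]
      refine ⟨Finset.mem_univ _, ne_of_gt ?_⟩
      exact (lt_of_le_of_ne (h0 _) (Ne.symm hi)).trans_le (hanti hj)
    have := Finset.card_le_card this
    rw [← hcard, Fin.card_Iic] at this
    rw [Fin.lt_def] at hlt
    simp only at hlt
    omega

end Matrix

/-! ### Smooth functions on a Hilbert space -/

section Smooth

variable {E F : Type*} [NormedAddCommGroup E] [InnerProductSpace ℝ E] [CompleteSpace E]
  [NormedAddCommGroup F] [InnerProductSpace ℝ F] [CompleteSpace F]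

/-- The descent lemma: the quadratic upper bound for a function with Lipschitz gradient. -/
theorem LipschitzWith.le_add_inner_gradient_add {g : E → ℝ} {L : ℝ≥0} (hg : Differentiable ℝ g)
    (hL : LipschitzWith L (∇ g)) (x y : E) :
    g y ≤ g x + ⟪∇ g x, y - x⟫ + L / 2 * ‖y - x‖ ^ 2 := by
  let φ : ℝ → ℝ := fun t => g (x + t • (y - x)) - t * ⟪∇ g x, y - x⟫ - L / 2 * t ^ 2 * ‖y - x‖ ^ 2
  have hφ (t : ℝ) : HasDerivAt φ
      (⟪∇ g (x + t • (y - x)), y - x⟫ - ⟪∇ g x, y - x⟫ - L * t * ‖y - x‖ ^ 2) t := by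
    have h1 : HasDerivAt (fun t : ℝ => x + t • (y - x)) (y - x) t := by
      simpa using ((hasDerivAt_id t).smul_const (y - x)).const_add x
    have h2 := (hg (x + t • (y - x))).hasGradientAt.hasFDerivAt.comp_hasDerivAt t h1
    have h3 := (hasDerivAt_id t).mul_const ⟪∇ g x, y - x⟫
    have h4 := ((hasDerivAt_pow 2 t).const_mul ((L : ℝ) / 2)).mul_const (‖y - x‖ ^ 2)
    refine ((h2.sub h3).sub h4).congr_deriv ?_
    rw [InnerProductSpace.toDual_apply_apply]
    push_cast
    ring
  have hanti : AntitoneOn φ (Set.Icc 0 1) := by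
    refine antitoneOn_of_deriv_nonpos (convex_Icc 0 1)
      (fun t _ => (hφ t).continuousAt.continuousWithinAt)
      (fun t _ => (hφ t).differentiableAt.differentiableWithinAt) fun t ht => ?_
    rw [interior_Icc] at ht
    rw [(hφ t).deriv, ← inner_sub_left]
    have h1 := real_inner_le_norm (∇ g (x + t • (y - x)) - ∇ g x) (y - x)
    have h2 := hL.norm_sub_le (x + t • (y - x)) x
    rw [add_sub_cancel_left, norm_smul, Real.norm_of_nonneg ht.1.le] at h2
    have := mul_le_mul_of_nonneg_right h2 (norm_nonneg (y - x))
    linarith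
  have := hanti (by simp) (by simp) zero_le_one
  simp only [φ, one_smul, zero_smul, add_zero, add_sub_cancel] at this
  linarith

theorem HasGradientAt.comp_clm_add_inner {g : F → ℝ} {g' : F} (A : E →L[ℝ] F) (C x : E)
    (hg : HasGradientAt g g' (A x)) :
    HasGradientAt (fun x => g (A x) + ⟪C, x⟫) (A.adjoint g' + C) x := by
  have h1 : HasFDerivAt g (InnerProductSpace.toDual ℝ F g') (A x) := hg.hasFDerivAt
  have h2 := (innerSL ℝ C).hasFDerivAt (x := x)
  rw [hasGradientAt_iff_hasFDerivAt]
  refine ((h1.comp x A.hasFDerivAt).add h2).congr_fderiv ?_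
  ext v
  simp [ContinuousLinearMap.adjoint_inner_left]

/-- First-order lower bound for a function that is convex on a set. -/
theorem ConvexOn.add_inner_le {f : E → ℝ} {s : Set E} (hf : ConvexOn ℝ s f) {x y f' : E}
    (hx : x ∈ s) (hy : y ∈ s) (h : HasGradientAt f f' x) : f x + ⟪f', y - x⟫ ≤ f y := by
  have h1 : HasDerivAt (fun t : ℝ => x + t • (y - x)) (y - x) 0 := by
    simpa using ((hasDerivAt_id (0 : ℝ)).smul_const (y - x)).const_add x
  have h2 : HasDerivAt (fun t : ℝ => f (x + t • (y - x))) ⟪f', y - x⟫ 0 := by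
    have h' : HasGradientAt f f' (x + (0 : ℝ) • (y - x)) := by simpa using h
    exact (h'.hasFDerivAt.comp_hasDerivAt (0 : ℝ) h1).congr_deriv
      (InnerProductSpace.toDual_apply_apply ..)
  have h3 := h2.tendsto_slope_zero_right
  have h4 : ⟪f', y - x⟫ ≤ f y - f x := by
    refine le_of_tendsto h3 ?_
    filter_upwards [Ioo_mem_nhdsGT (zero_lt_one (α := ℝ))] with t ht
    have h5 := hf.2 hx hy (sub_nonneg.mpr ht.2.le) ht.1.le (by ring)
    have h6 : (1 - t) • x + t • y = x + t • (y - x) := by module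
    rw [h6] at h5
    simp only [zero_add, zero_smul, add_zero, smul_eq_mul] at h5 ⊢
    rw [inv_mul_le_iff₀ ht.1]
    linarith
  linarith

end Smooth

/-! ### The trace inner product and the spectrahedron -/

namespace SymMat

variable {n k : ℕ}

theorem inner_eq_trace (X Y : SymMat n) : ⟪X, Y⟫ = (mat X * mat Y).trace := rfl

theorem norm_sq_eq_trace (X : SymMat n) : ‖X‖ ^ 2 = (mat X * mat X).trace := by
  rw [← real_inner_self_eq_norm_sq]; rfl

theorem mat_conj (V : Matrix (Fin n) (Fin k) ℝ) (S : SymMat k) :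
    mat (conj V S) = V * mat S * Vᵀ := rfl

theorem mat_id : mat (SymMat.id n) = 1 := rfl

/-- The quadratic form of a symmetric matrix is bounded by its Frobenius norm. -/
theorem abs_dotProduct_mulVec_le (E : SymMat n) (u : Fin n → ℝ) :
    |u ⬝ᵥ mat E *ᵥ u| ≤ ‖E‖ * (u ⬝ᵥ u) := by
  let W : SymMat n := ofMat (Matrix.vecMulVec u u) (by
    rw [Matrix.IsSymm, Matrix.transpose_vecMulVec])
  have h0 : 0 ≤ u ⬝ᵥ u := by simpa using dotProduct_star_self_nonneg u
  have h1 : ⟪E, W⟫ = u ⬝ᵥ mat E *ᵥ u := by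
    rw [inner_eq_trace, mat_ofMat, Matrix.mul_vecMulVec, Matrix.trace_vecMulVec, dotProduct_comm]
  have h2 : ‖W‖ = u ⬝ᵥ u := by
    rw [← sq_eq_sq₀ (norm_nonneg _) h0, norm_sq_eq_trace, mat_ofMat, Matrix.vecMulVec_mul_vecMulVec,
      Matrix.trace_vecMulVec, dotProduct_smul, smul_eq_mul, sq]
  rw [← h1, ← h2]
  exact abs_real_inner_le_norm E W

end SymMat

namespace spectrahedron

open SymMat

variable {n k : ℕ}

theorem norm_sub_sq_le {X Y : SymMat n} (hX : X ∈ spectrahedron n) (hY : Y ∈ spectrahedron n) :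
    ‖X - Y‖ ^ 2 ≤ 2 := by
  have h1 := hX.1.trace_mul_le hX.1
  have h2 := hY.1.trace_mul_le hY.1
  have h3 := hX.1.trace_mul_nonneg hY.1
  rw [hX.2] at h1
  rw [hY.2] at h2
  rw [norm_sub_sq_real, norm_sq_eq_trace, norm_sq_eq_trace, inner_eq_trace]
  linarith

theorem norm_le_one {X : SymMat n} (hX : X ∈ spectrahedron n) : ‖X‖ ≤ 1 := by
  have h1 := hX.1.trace_mul_le hX.1
  rw [hX.2, ← norm_sq_eq_trace] at h1
  nlinarith [norm_nonneg X]

theorem smul_add_conj_mem {X : SymMat n} (hX : X ∈ spectrahedron n)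
    {V : Matrix (Fin n) (Fin k) ℝ} (hV : Vᵀ * V = 1) {p : ℝ × SymMat k}
    (hp : p ∈ subproblemFeasible k) : p.1 • X + conj V p.2 ∈ spectrahedron n := by
  obtain ⟨h1, h2, h3⟩ := hp
  constructor
  · rw [map_add, map_smul, mat_conj]
    exact (hX.1.smul h3).add (by simpa using h2.mul_mul_conjTranspose_same V)
  · rw [map_add, map_smul, mat_conj, Matrix.trace_add, Matrix.trace_smul, hX.2,
      Matrix.trace_mul_comm, ← Matrix.mul_assoc, hV, Matrix.one_mul, smul_eq_mul, mul_one, h1]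

end spectrahedron

/-! ### The objective -/

section Objective

open SymMat

variable {n m : ℕ} {g : EuclideanSpace ℝ (Fin m) → ℝ}
  {A : SymMat n →L[ℝ] EuclideanSpace ℝ (Fin m)} {C : SymMat n} {Lg : ℝ≥0}

theorem hasGradientAt_objective (hg : Differentiable ℝ g) (X : SymMat n) :
    HasGradientAt (objective g A C) (A.adjoint (∇ g (A X)) + C) X :=
  (hg (A X)).hasGradientAt.comp_clm_add_inner A C X

theorem gradient_objective (hg : Differentiable ℝ g) (X : SymMat n) :
    ∇ (objective g A C) X = A.adjoint (∇ g (A X)) + C :=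
  (hasGradientAt_objective hg X).gradient

theorem objective_le_quadratic (hg : Differentiable ℝ g) (hLg : LipschitzWith Lg (∇ g))
    (X Y : SymMat n) :
    objective g A C Y ≤ objective g A C X + ⟪∇ (objective g A C) X, Y - X⟫
      + ‖A‖ ^ 2 * Lg / 2 * ‖Y - X‖ ^ 2 := by
  have h := LipschitzWith.le_add_inner_gradient_add hg hLg (A X) (A Y)
  have h1 : ‖A Y - A X‖ ^ 2 ≤ (‖A‖ * ‖Y - X‖) ^ 2 := by
    rw [← map_sub]
    gcongr
    exact A.le_opNorm _
  have h2 := mul_le_mul_of_nonneg_left h1 (by positivity : (0 : ℝ) ≤ Lg / 2)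
  rw [gradient_objective hg, inner_add_left, ContinuousLinearMap.adjoint_inner_left, map_sub,
    inner_sub_right C]
  unfold objective
  linarith

theorem norm_gradient_objective_sub_le (hg : Differentiable ℝ g) (hLg : LipschitzWith Lg (∇ g))
    (X Y : SymMat n) :
    ‖∇ (objective g A C) X - ∇ (objective g A C) Y‖ ≤ ‖A‖ ^ 2 * Lg * ‖X - Y‖ := by
  rw [gradient_objective hg, gradient_objective hg, add_sub_add_right_eq_sub, ← map_sub]
  have h1 := A.adjoint.le_opNorm (∇ g (A X) - ∇ g (A Y))
  have h2 := hLg.norm_sub_le (A X) (A Y)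
  have h3 := A.le_opNorm (X - Y)
  rw [LinearIsometryEquiv.norm_map] at h1
  rw [map_sub] at h3
  calc _ ≤ _ := h1
    _ ≤ ‖A‖ * (Lg * (‖A‖ * ‖X - Y‖)) := by
      gcongr
      exact h2.trans (by gcongr)
    _ = _ := by ring

theorem objective_sub_le_inner (hg : Differentiable ℝ g)
    (hconv : ConvexOn ℝ (spectrahedron n) (objective g A C)) {X Y : SymMat n}
    (hX : X ∈ spectrahedron n) (hY : Y ∈ spectrahedron n) :
    objective g A C X - objective g A C Y ≤ ⟪∇ (objective g A C) X, X - Y⟫ := by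
  have h := hconv.add_inner_le hX hY (hasGradientAt_objective hg X)
  rw [gradient_objective hg, ← neg_sub Y X, inner_neg_right]
  linarith

end Objective

/-! ### Progress of the iteration -/

section Progress

open SymMat

variable {n k : ℕ} {f : SymMat n → ℝ} {X Y : SymMat n}

/-- The eigenvector equations for the columns of `V`, as one matrix equation. -/
theorem IsBottomEigenbasis.exists_diagonal {G : SymMat n} {V : Matrix (Fin n) (Fin k) ℝ}
    (h : IsBottomEigenbasis G V) :
    ∃ μ : Fin k → ℝ, G.mat * V = V * Matrix.diagonal μ ∧
      ∀ (ν : ℝ) (w : Fin n → ℝ), w ≠ 0 → Vᵀ *ᵥ w = 0 → G.mat *ᵥ w = ν • w → ∀ j, μ j ≤ ν := by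
  obtain ⟨-, μ, h1, h2⟩ := h
  refine ⟨μ, ?_, h2⟩
  ext i j
  have := congrFun (h1 j) i
  rw [Matrix.mul_diagonal, mul_comm]
  exact this

theorem IsSpecFWStep.mem_spectrahedron (h : IsSpecFWStep f k X Y) (hX : X ∈ spectrahedron n) :
    Y ∈ spectrahedron n := by
  obtain ⟨V, p, hV, hp, -, rfl⟩ := h
  exact spectrahedron.smul_add_conj_mem hX hV.1 hp

theorem IsSpecFWRun.mem_spectrahedron {X : ℕ → SymMat n} (h : IsSpecFWRun f k X) (t : ℕ) :
    X t ∈ spectrahedron n := by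
  induction t with
  | zero => exact h.1
  | succ t ih => exact (h.2 t).mem_spectrahedron ih

theorem IsSpecFWStep.le (h : IsSpecFWStep f k X Y) : f Y ≤ f X := by
  obtain ⟨V, p, hV, -, hmin, rfl⟩ := h
  have h0 := hmin (1, 0) ⟨by simp, by simpa using Matrix.PosSemidef.zero, zero_le_one⟩
  have : conj V (0 : SymMat k) = 0 := mat_injective (by simp [mat_conj])
  simpa [this] using h0

/-- The new iterate does at least as well as every point of the segment from `X` to `V S Vᵀ`. -/
theorem IsSpecFWStep.exists_frame (h : IsSpecFWStep f k X Y) :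
    ∃ V : Matrix (Fin n) (Fin k) ℝ, IsBottomEigenbasis (∇ f X) V ∧
      ∀ S ∈ spectrahedron k, ∀ η ∈ Set.Icc (0 : ℝ) 1, f Y ≤ f (X + η • (conj V S - X)) := by
  obtain ⟨V, p, hV, -, hmin, rfl⟩ := h
  refine ⟨V, hV, fun S hS η hη => ?_⟩
  have h0 := hmin (1 - η, η • S) ⟨by simp [hS.2], by simpa using hS.1.smul hη.1, by simpa using hη.2⟩
  refine h0.trans_eq (congrArg f ?_)
  have : conj V (η • S) = η • conj V S := mat_injective (by simp [mat_conj])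
  rw [this]
  module

/-- The linear function `⟪G, ·⟫` attains its minimum over the spectrahedron at a bottom eigenvector,
hence at a point `V S Vᵀ`. -/
theorem IsBottomEigenbasis.exists_inner_le {G : SymMat n} {V : Matrix (Fin n) (Fin k) ℝ}
    (h : IsBottomEigenbasis G V) (hk : 0 < k) {M : SymMat n} (hM : M ∈ spectrahedron n) :
    ∃ S ∈ spectrahedron k, ⟪G, conj V S⟫ ≤ ⟪G, M⟫ := by
  obtain ⟨μ, hGV, hc⟩ := h.exists_diagonal
  have : Nonempty (Fin k) := ⟨⟨0, hk⟩⟩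
  obtain ⟨j, hj⟩ := Finite.exists_min μ
  have hE : (Matrix.single j j (1 : ℝ)).IsSymm := Matrix.transpose_single ..
  refine ⟨ofMat (Matrix.single j j 1) hE, ⟨?_, by simp⟩, ?_⟩
  · rw [mat_ofMat, ← Matrix.diagonal_single]
    exact Matrix.PosSemidef.diagonal (by intro i; by_cases h : i = j <;> simp [h])
  · have h1 := G.isHermitian.mul_trace_le h.1 hGV hj (fun ν w h1 h2 h3 => hc ν w h1 h2 h3 j) hM.1
    rw [hM.2, mul_one] at h1
    refine le_trans (le_of_eq ?_) h1
    rw [inner_eq_trace, mat_conj, mat_ofMat, ← Matrix.mul_assoc, ← Matrix.mul_assoc, hGV,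
      Matrix.trace_mul_comm]
    simp only [← Matrix.mul_assoc, h.1, Matrix.one_mul]
    rw [← Matrix.diagonal_single, Matrix.diagonal_mul_diagonal, Matrix.trace_diagonal]
    simp [Pi.single_apply]

/-- If `G` is within `δ / 3` of `Z + s I`, where `Z` has its nonzero eigenvalues above `δ` and is
complementary to `Xs`, and if `k ≥ n - rank Z`, then the eigenvalues of `G` beyond the `k` smallest
exceed the least one by at least `δ / 3`. Hence some `V S Vᵀ` has a smaller inner product with `G`
than `Xs`, by at least `δ / 6` times its squared distance to `Xs`. -/
theorem IsBottomEigenbasis.exists_near {G Xs Z : SymMat n} {V : Matrix (Fin n) (Fin k) ℝ}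
    {s δ : ℝ} (h : IsBottomEigenbasis G V) (hk : 0 < k) (hXs : Xs ∈ spectrahedron n)
    (hZX : ⟪Z, Xs⟫ = 0) (hG : ‖G - (Z + s • SymMat.id n)‖ ≤ δ / 3)
    (hZ : ∀ u ∈ LinearMap.range Z.mat.mulVecLin, δ * (u ⬝ᵥ u) ≤ u ⬝ᵥ Z.mat *ᵥ u)
    (hrank : n ≤ Z.mat.rank + k) :
    ∃ S ∈ spectrahedron k, ∃ τ : ℝ, 0 ≤ τ ∧ ‖Xs - conj V S‖ ^ 2 ≤ 2 * τ ∧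
      δ / 3 * τ ≤ ⟪G, Xs - conj V S⟫ := by
  obtain ⟨μ, hGV, hc⟩ := h.exists_diagonal
  have : Nonempty (Fin k) := ⟨⟨0, hk⟩⟩
  obtain ⟨j, hj⟩ := Finite.exists_min μ
  set E := G - (Z + s • SymMat.id n) with hE
  have hGE : G = Z + s • SymMat.id n + E := by rw [hE]; abel
  -- The least eigenvalue of `G` is at most `⟪G, Xs⟫ = s + ⟪E, Xs⟫`.
  have hμ : μ j ≤ s + δ / 3 := by
    have h1 := G.isHermitian.mul_trace_le h.1 hGV hj (fun ν w h1 h2 h3 => hc ν w h1 h2 h3 j) hXs.1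
    have h2 : ⟪SymMat.id n, Xs⟫ = 1 := by rw [inner_eq_trace, mat_id, Matrix.one_mul, hXs.2]
    have h3 : ⟪G, Xs⟫ = s + ⟪E, Xs⟫ := by
      rw [hGE, inner_add_left, inner_add_left, inner_smul_left, hZX, h2]; simp
    rw [hXs.2, mul_one, ← inner_eq_trace, h3] at h1
    have h4 := real_inner_le_norm E Xs
    have h5 := mul_le_of_le_one_right (norm_nonneg E) (spectrahedron.norm_le_one hXs)
    linarith
  have hcompl (ν : ℝ) (w : Fin n → ℝ) (hw : w ≠ 0) (hVw : Vᵀ *ᵥ w = 0)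
      (hGw : G.mat *ᵥ w = ν • w) : s + 2 * δ / 3 ≤ ν := by
    refine Matrix.le_eigenvalue_of_subspace h.1 hGV (LinearMap.range Z.mat.mulVecLin)
      (fun u hu => ?_) (by rwa [Fintype.card_fin, Fintype.card_fin]) hw hVw hGw (hc ν w hw hVw hGw)
    have h0 : 0 ≤ u ⬝ᵥ u := by simpa using dotProduct_star_self_nonneg u
    have h1 := hZ u hu
    have h2 := (abs_le.mp (E.abs_dotProduct_mulVec_le u)).1
    have h3 := mul_le_mul_of_nonneg_right hG h0
    rw [hGE, map_add, map_add, map_smul, mat_id, Matrix.add_mulVec, Matrix.add_mulVec,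
      Matrix.smul_mulVec, Matrix.one_mulVec, dotProduct_add, dotProduct_add, dotProduct_smul,
      smul_eq_mul]
    linarith
  obtain ⟨S, hS, hS1, hdist, hinner⟩ :=
    Matrix.exists_compression_approx h.1 hGV hXs.1 hXs.2 j
  have hτ := (Matrix.posSemidef_one_sub_mul_transpose h.1).trace_mul_nonneg hXs.1
  refine ⟨ofMat S (by simpa [Matrix.IsSymm, Matrix.IsHermitian] using hS.isHermitian), ⟨hS, hS1⟩,
    _, hτ, ?_, ?_⟩
  · rwa [norm_sq_eq_trace]
  · have h1 := G.isHermitian.le_trace_mul_compl h.1 hGV hcompl hXs.1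
    rw [inner_eq_trace, map_sub, mat_conj, mat_ofMat, hinner]
    have h2 := mul_le_mul_of_nonneg_right hμ hτ
    linarith

/-- The progress of a classical Frank-Wolfe step. The spectrahedron has squared diameter `2`. -/
theorem IsSpecFWStep.sub_le_frankWolfe {Xs : SymMat n} {β η : ℝ} (h : IsSpecFWStep f k X Y)
    (hβ : 0 ≤ β)
    (hquad : ∀ X Y, f Y ≤ f X + ⟪∇ f X, Y - X⟫ + β / 2 * ‖Y - X‖ ^ 2)
    (hX : X ∈ spectrahedron n) (hXs : Xs ∈ spectrahedron n)
    (hlin : f X - f Xs ≤ ⟪∇ f X, X - Xs⟫) (hk : 0 < k) (hη : η ∈ Set.Icc (0 : ℝ) 1) :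
    f Y - f Xs ≤ (1 - η) * (f X - f Xs) + β * η ^ 2 := by
  obtain ⟨V, hV, hmin⟩ := h.exists_frame
  obtain ⟨S, hS, hle⟩ := hV.exists_inner_le hk hXs
  have hU : conj V S ∈ spectrahedron n := by
    simpa using spectrahedron.smul_add_conj_mem hX hV.1 (p := (0, S)) ⟨by simp [hS.2], hS.1, le_rfl⟩
  have h1 := hmin S hS η hη
  have h2 := hquad X (X + η • (conj V S - X))
  have h3 := mul_le_mul_of_nonneg_left (spectrahedron.norm_sub_sq_le hU hX)
    (by positivity : 0 ≤ β / 2 * η ^ 2)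
  rw [add_sub_cancel_left, inner_smul_right, inner_sub_right, norm_smul, mul_pow, Real.norm_eq_abs,
    sq_abs] at h2
  rw [inner_sub_right] at hlin
  have h4 := mul_le_mul_of_nonneg_left (by linarith : ⟪∇ f X, conj V S⟫ - ⟪∇ f X, X⟫
    ≤ - (f X - f Xs)) hη.1
  linarith

/-- Geometric decrease once the gradient is close to `Z + s I`, the gradient at the solution. -/
theorem IsSpecFWStep.sub_le_of_gap {Xs Z : SymMat n} {s β γ δ η : ℝ} (h : IsSpecFWStep f k X Y)
    (hβ : 0 ≤ β)
    (hquad : ∀ X Y, f Y ≤ f X + ⟪∇ f X, Y - X⟫ + β / 2 * ‖Y - X‖ ^ 2)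
    (hXs : Xs ∈ spectrahedron n)
    (hlin : f X - f Xs ≤ ⟪∇ f X, X - Xs⟫) (hgrowth : γ * ‖X - Xs‖ ^ 2 ≤ f X - f Xs)
    (hk : 0 < k)
    (hZX : ⟪Z, Xs⟫ = 0) (hG : ‖∇ f X - (Z + s • SymMat.id n)‖ ≤ δ / 3)
    (hZ : ∀ u ∈ LinearMap.range Z.mat.mulVecLin, δ * (u ⬝ᵥ u) ≤ u ⬝ᵥ Z.mat *ᵥ u)
    (hrank : n ≤ Z.mat.rank + k) (hη : η ∈ Set.Icc (0 : ℝ) 1)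
    (hηγ : η * (2 * β) ≤ γ) (hηδ : η * (6 * β) ≤ δ) :
    f Y - f Xs ≤ (1 - η / 2) * (f X - f Xs) := by
  obtain ⟨V, hV, hmin⟩ := h.exists_frame
  obtain ⟨S, hS, τ, hτ, hdist, hinner⟩ := hV.exists_near hk hXs hZX hG hZ hrank
  have h1 := hmin S hS η hη
  have h2 := hquad X (X + η • (conj V S - X))
  rw [add_sub_cancel_left, inner_smul_right, norm_smul, mul_pow, Real.norm_eq_abs, sq_abs] at h2
  have hsplit : conj V S - X = -(Xs - conj V S) - (X - Xs) := by abel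
  have h3 : ⟪∇ f X, conj V S - X⟫ ≤ -(δ / 3 * τ) - (f X - f Xs) := by
    rw [hsplit, inner_sub_right, inner_neg_right]
    linarith
  have h4 : ‖conj V S - X‖ ^ 2 ≤ 4 * τ + 2 * ‖X - Xs‖ ^ 2 := by
    have := parallelogram_law_with_norm ℝ (-(Xs - conj V S)) (X - Xs)
    rw [norm_neg, ← hsplit] at this
    nlinarith [mul_self_nonneg ‖-(Xs - conj V S) + (X - Xs)‖]
  have h5 := mul_le_mul_of_nonneg_left h3 hη.1
  have h6 := mul_le_mul_of_nonneg_left h4 (by positivity : 0 ≤ β / 2 * η ^ 2)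
  have h7 := mul_le_mul_of_nonneg_left hηδ (mul_nonneg hη.1 hτ)
  have h8 := mul_le_mul_of_nonneg_left hηγ (mul_nonneg hη.1 (sq_nonneg ‖X - Xs‖))
  have h9 := mul_le_mul_of_nonneg_left hgrowth hη.1
  linarith

theorem IsSpecFWRun.sub_le {X : ℕ → SymMat n} {Xs : SymMat n} {β : ℝ} (h : IsSpecFWRun f k X)
    (hβ : 0 ≤ β)
    (hquad : ∀ X Y, f Y ≤ f X + ⟪∇ f X, Y - X⟫ + β / 2 * ‖Y - X‖ ^ 2)
    (hXs : Xs ∈ spectrahedron n)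
    (hlin : ∀ X ∈ spectrahedron n, f X - f Xs ≤ ⟪∇ f X, X - Xs⟫) (hk : 0 < k) (t : ℕ) :
    f (X (t + 1)) - f Xs ≤ 4 * β / (t + 3) := by
  have step (t : ℕ) {η : ℝ} (hη : η ∈ Set.Icc (0 : ℝ) 1) :
      f (X (t + 1)) - f Xs ≤ (1 - η) * (f (X t) - f Xs) + β * η ^ 2 :=
    (h.2 t).sub_le_frankWolfe hβ hquad (h.mem_spectrahedron t) hXs
      (hlin _ (h.mem_spectrahedron t)) hk hη
  induction t with
  | zero =>
    have := step 0 (η := 1) (by simp)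
    norm_num at this ⊢
    linarith
  | succ t ih =>
    have ht : (0 : ℝ) ≤ t := t.cast_nonneg
    have h1 := step (t + 1) (η := 2 / (t + 3))
      ⟨by positivity, by rw [div_le_one (by positivity)]; linarith⟩
    have h0 : (0 : ℝ) ≤ 1 - 2 / (t + 3) := by
      rw [sub_nonneg, div_le_one (by positivity)]; linarith
    refine h1.trans ((add_le_add_left (mul_le_mul_of_nonneg_left ih h0) _).trans ?_)
    have e : (1 - 2 / ((t : ℝ) + 3)) * (4 * β / (t + 3)) + β * (2 / (t + 3)) ^ 2
        = 4 * β * (t + 2) / (t + 3) ^ 2 := by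
      field_simp
      ring
    rw [e, div_le_div_iff₀ (by positivity) (by positivity)]
    push_cast
    nlinarith

end Progress

theorem theorem1 {n m : ℕ} (g : EuclideanSpace ℝ (Fin m) → ℝ)
    (A : SymMat n →L[ℝ] EuclideanSpace ℝ (Fin m)) (C : SymMat n)
    (Lg : ℝ≥0) (γ β s : ℝ) (Xs Zs : SymMat n) (k r : ℕ) (X : ℕ → SymMat n)
    (hg : Differentiable ℝ g) (hLg : LipschitzWith Lg (∇ g))
    (hconv : ConvexOn ℝ (spectrahedron n) (objective g A C))
    (hsol : IsUniqueSolution (objective g A C) Xs)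
    (hr : Xs.mat.rank = r)
    (hsc : StrictComplementarity (objective g A C) Xs Zs s)
    (hqg : QuadraticGrowth (objective g A C) Xs γ)
    (hk : r ≤ k)
    (hβ : β = ‖A‖ ^ 2 * Lg)
    (hX : IsSpecFWRun (objective g A C) k X) :
    (∀ t : ℕ, 1 ≤ t →
      objective g A C (X t) - objective g A C Xs ≤ 8 * β / t) ∧
    (∀ hrn : r < n, ∀ t : ℕ,
      72 * β ^ 3 / (γ * Zs.eigval (n - r) (by omega) (by omega) ^ 2) ≤ t →
      objective g A C (X (t + 1)) - objective g A C Xs ≤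
        (1 - min (1 / 2) (min (γ / (4 * β))
            (Zs.eigval (n - r) (by omega) (by omega) / (12 * β)))) *
          (objective g A C (X t) - objective g A C Xs)) := by
  -- `Xs` has trace one, so it is nonzero; in particular `V` has at least one column.
  have hr0 : 0 < r := by
    rw [← hr, Nat.pos_iff_ne_zero]
    intro h0
    have h1 := hsol.1.2
    rw [Matrix.rank, Submodule.finrank_eq_zero, LinearMap.range_eq_bot,
      ← Matrix.toLin'_apply', LinearEquiv.map_eq_zero_iff] at h0
    rw [h0, Matrix.trace_zero] at h1
    exact zero_ne_one h1
  have hk0 : 0 < k := hr0.trans_le hk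
  have hβ0 : 0 ≤ β := by rw [hβ]; positivity
  have hquad (X Y : SymMat n) := objective_le_quadratic (A := A) (C := C) hg hLg X Y
  rw [← hβ] at hquad
  have hlin (X : SymMat n) (hX : X ∈ spectrahedron n) :=
    objective_sub_le_inner hg hconv hX hsol.1
  have hsub (t : ℕ) (ht : 1 ≤ t) :
      objective g A C (X t) - objective g A C Xs ≤ 8 * β / t := by
    obtain ⟨t, rfl⟩ := Nat.exists_eq_add_of_le' ht
    refine (hX.sub_le hβ0 hquad hsol.1 hlin hk0 t).trans ?_
    push_cast
    gcongr <;> linarith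
  refine ⟨hsub, fun hrn t ht => ?_⟩
  have hXt := hX.mem_spectrahedron t
  obtain ⟨hkkt, hrank⟩ := hsc
  rw [hr] at hrank
  obtain ⟨hδ0, hδ⟩ := hkkt.dual_psd.eigenvalues₀_pos_and_le (q := n - r) (by omega) (by omega)
    (by rw [Fintype.card_fin]; omega)
  change 0 < Zs.eigval (n - r) (by omega) (by omega) at hδ0
  change ∀ i, _ → Zs.eigval (n - r) (by omega) (by omega) ≤ _ at hδ
  set δ := Zs.eigval (n - r) (by omega) (by omega)
  obtain ⟨hγ, hgrowth⟩ := hqg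
  have hgr := hgrowth _ hXt
  rcases hβ0.eq_or_lt with hβ1 | hβ1
  · -- For `β = 0` the minimum is `0`, as `γ / 0 = 0`; the claim is that `f` does not increase.
    have := (hX.2 t).le
    simp only [← hβ1, mul_zero, div_zero]
    norm_num
    exact this
  have ht0 : (0 : ℝ) < t := lt_of_lt_of_le (by positivity) ht
  have hh := hsub t (by exact_mod_cast ht0)
  rw [le_div_iff₀ ht0] at hh
  rw [div_le_iff₀ (by positivity)] at ht
  have hgrad : ‖∇ (objective g A C) (X t) - (Zs + s • SymMat.id n)‖ ≤ δ / 3 := by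
    have h1 : Zs + s • SymMat.id n = ∇ (objective g A C) Xs := by
      rw [eq_comm, ← sub_eq_zero, ← hkkt.first_order]; abel
    rw [h1]
    refine (norm_gradient_objective_sub_le hg hLg _ _).trans ?_
    rw [← hβ]
    -- `(β ‖X t - Xs‖)² γ t ≤ β² h t ≤ 8 β³ ≤ (δ / 3)² γ t`
    refine le_of_sq_le_sq ?_ (by positivity)
    refine le_of_mul_le_mul_right ?_ (mul_pos hγ ht0)
    have h2 := mul_le_mul_of_nonneg_left hgr (mul_nonneg (sq_nonneg β) ht0.le)
    have h3 := mul_le_mul_of_nonneg_left hh (sq_nonneg β)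
    nlinarith
  set κ := min (1 / 2) (min (γ / (4 * β)) (δ / (12 * β))) with hκ
  have hκ0 : 0 ≤ κ := by positivity
  have hκ1 : κ ≤ 1 / 2 := min_le_left _ _
  have hκ2 : κ ≤ γ / (4 * β) := (min_le_right _ _).trans (min_le_left _ _)
  have hκ3 : κ ≤ δ / (12 * β) := (min_le_right _ _).trans (min_le_right _ _)
  rw [le_div_iff₀ (by positivity)] at hκ2 hκ3
  -- The decrease is by the factor `1 - η / 2`, whence the step size `2 κ`.
  have := (hX.2 t).sub_le_of_gap (η := 2 * κ) hβ0 hquad hsol.1 (hlin _ hXt) hgr hk0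
    hkkt.complementarity hgrad (fun u hu => hkkt.dual_psd.le_dotProduct_mulVec_of_mem_range hδ hu)
    (by omega) ⟨by linarith, by linarith⟩ (by linarith) (by linarith)
  rwa [mul_div_cancel_left₀ κ two_ne_zero] at this
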